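/- Let $n\ge 0$, let $[z_0:z_1:\cdots:z_n]$ be the homogeneous coordinates of $\mathbb{C}P^n$, and let $$X=\{[1:z_1:\cdots:z_n]\in\mathbb{C}P^n \mid z_i\neq 0\ (1\le i\le n)\}\cong(\mathbb{C}^*)^n,$$ with the restriction of the Fubini–Study metric. For a holomorphic map $f=[1:f_1:\cdots:f_n]:\mathbb{C}\to X$ put $|df|(z)=\sqrt2\,|df(\partial/\partial z)|$, where $\partial/\partial z=\frac12(\partial/\partial x-\sqrt{-1}\,\partial/\partial y)$; with the metric normalized as usual in Nevanlinna theory this is $$|df|^2(z)=\frac1\pi\cdot\frac{\bigl(1+\sum_i|f_i|^2\bigr)\sum_i|f_i'|^2-\bigl|\sum_i\overline{f_i}\,f_i'\bigr|^2}{\bigl(1+\sum_i|f_i|^2\bigr)^2}=\frac1{4\pi}\Delta\log\Bigl(1+\sum_{i}|f_i(z)|^2\Bigr).$$ Theorem. Let $f:\mathbb{C}\to X$ be a holomorphic map and let $m\ge 0$ be an integer. Then the following are equivalent. (a) There is a constant $C>0$ such that $|df|(z)\le C|z|^m$ for all $z\in\mathbb{C}$ with $|z|\ge 1$. (b) There are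 polynomials $g_1,\dots,g_n\in\mathbb{C}[z]$ with $\deg g_i\le m+1$ for $1\le i\le n$ such that $f(z)=[1:e^{g_1(z)}:\cdots:e^{g_n(z)}]$ for all $z\in\mathbb{C}$. -/

import Mathlib

open scoped LinearAlgebra.Projectivization

namespace TorusCurve

/-- Complex projective space of dimension `n`: the lines of `ℂ^(n+1)`, with homogeneous
coordinates indexed by `0, ..., n`. -/
abbrev CP (n : ℕ) : Type := ℙ ℂ (Fin (n + 1) → ℂ)

/-- The standard open set of the points whose `i`-th homogeneous coordinate does not vanish. -/
def affineOpen {n : ℕ} (i : Fin (n + 1)) : Set (CP n) :=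
  {p | ∃ (v : Fin (n + 1) → ℂ) (hv : v ≠ 0), v i ≠ 0 ∧ p = Projectivization.mk ℂ v hv}

/-- The standard affine chart on `affineOpen i`: it sends `[v_0 : ... : v_n]` to the vector of the
quotients `v_j / v_i`, `j ≠ i`, in increasing order of `j`. (Outside `affineOpen i` its value
is `0`.) -/
noncomputable def affineChart {n : ℕ} (i : Fin (n + 1)) : CP n → EuclideanSpace ℂ (Fin n) :=
  Projectivization.lift
    (fun v => WithLp.toLp 2 fun j => v.1 (i.succAbove j) / v.1 i)
    (by
      rintro ⟨a, ha⟩ ⟨b, hb⟩ t h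
      have h' : a = t • b := h
      have ht : t ≠ 0 := by
        rintro rfl
        exact ha (by simpa using h')
      subst h'
      congr 1
      funext j
      simp [mul_div_mul_left _ _ ht])

/-- A map from `ℂ` to projective space is holomorphic if, for each chart of the standard
atlas, the set of the points that are sent into the domain of the chart is open and the map is
holomorphic there in the coordinates of the chart. -/
def IsHolomorphic {n : ℕ} (f : ℂ → CP n) : Prop :=
  ∀ i : Fin (n + 1), IsOpen (f ⁻¹' affineOpen i) ∧
    DifferentiableOn ℂ (fun z => affineChart i (f z)) (f ⁻¹' affineOpen i)

theorem cons_one_ne_zero {n : ℕ} (w : Fin n → ℂ) : (Fin.cons 1 w : Fin (n + 1) → ℂ) ≠ 0 :=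
  fun h => one_ne_zero (congrFun h 0)

/-- The point `[1 : w_1 : ... : w_n]`. -/
noncomputable def point {n : ℕ} (w : Fin n → ℂ) : CP n :=
  Projectivization.mk ℂ (Fin.cons 1 w) (cons_one_ne_zero w)

/-- The algebraic torus `{[1 : w_1 : ... : w_n] | w_i ≠ 0}` in projective space. -/
def torus (n : ℕ) : Set (CP n) :=
  {p | ∃ w : Fin n → ℂ, (∀ i, w i ≠ 0) ∧ p = point w}

/-- The Fubini–Study Hermitian inner product of the `(1,0)`-vectors `∑ v_j ∂/∂z_j` and
`∑ w_j ∂/∂z_j` at the point with coordinates `u` of an affine chart. The normalization is such that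
the real metric at `u = 0` is `1/π` times the Euclidean one, for which `∂/∂z_j` has
length `1/√2`. -/
noncomputable def fubiniStudy {n : ℕ} (u v w : EuclideanSpace ℂ (Fin n)) : ℂ :=
  1 / (2 * (Real.pi : ℂ)) *
    (((1 + (‖u‖ : ℂ) ^ 2) * inner ℂ v w - inner ℂ v u * inner ℂ u w) / (1 + (‖u‖ : ℂ) ^ 2) ^ 2)

/-- The norm `|df|(z) = √2 |df(∂/∂z)|` of the differential of a holomorphic curve in the torus, in the
Fubini–Study metric. It is computed in the chart `[1 : w_1 : ... : w_n] ↦ (w_1, ..., w_n)`, whose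
domain contains the torus, and in which `df(∂/∂z) = ∑ f_j'(z) ∂/∂w_j`. -/
noncomputable def normDiff {n : ℕ} (f : ℂ → CP n) (z : ℂ) : ℝ :=
  let u := affineChart 0 (f z)
  let v := deriv (fun ζ => affineChart 0 (f ζ)) z
  √2 * √(fubiniStudy u v v).re

end TorusCurve

/-!
Lift a curve in the torus to `F = (1, exp g₁, …, exp gₙ)` with entire `gᵢ`. Up to a constant
factor `|df|²` is the density `∂∂̄ log ‖F‖²`, and Lagrange's identity writes it as a sum of
squares in the differences `gᵢ' - gⱼ'`, weighted by the products `|exp gᵢ|² |exp gⱼ|²`.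

If the density has polynomial growth, Green's theorem in the coordinate `w = log z`, where circles
become vertical periods, shows that the circle averages of `log ‖F‖` grow at most polynomially.
Since `log ‖F‖` is nonnegative and dominates each `Re gᵢ`, the Poisson formula and the
Borel–Carathéodory inequality make every `gᵢ` a polynomial.

Suppose that the maximal degree `k` of the `gᵢ` exceeds `m + 1`, and let `A` be the set of those
indices whose coefficient of `z ^ k` is a fixed one of maximal modulus. The coordinates in `A`
dominate `F` on one ray, those outside `A`, among them the coordinate `1`, dominate on another. So
each large circle carries a point at which both parts of `F` have the same norm. There the density
is at least `|gᵢ' - gⱼ'|² / 4` for some `i ∈ A`, `j ∉ A`, which is too large because `gᵢ - gⱼ` has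
degree `k`.
-/

namespace TorusCurve

open Complex Filter MeasureTheory Bornology Topology
open scoped Real ComplexConjugate

section Wirtinger

/-- The Wirtinger derivative `∂P/∂z̄ = (∂P/∂x + i ∂P/∂y) / 2`, the integrand in the complex form of
Green's theorem. -/
noncomputable def dbar (P : ℂ → ℂ) (z : ℂ) : ℂ := (fderiv ℝ P z 1 + I * fderiv ℝ P z I) / 2

theorem dbar_mul {P Q : ℂ → ℂ} {z : ℂ} (hP : DifferentiableAt ℝ P z)
    (hQ : DifferentiableAt ℝ Q z) :
    dbar (fun z => P z * Q z) z = P z * dbar Q z + dbar P z * Q z := by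
  simp only [dbar, fderiv_fun_mul hP hQ, add_apply, FunLike.coe_smul, Pi.smul_apply,
    smul_eq_mul]
  ring

theorem integral_vertical_eq_add_integral_dbar {P : ℂ → ℂ} {T : ℝ} (hP : Differentiable ℝ P)
    (hdP : Continuous (dbar P)) (hT : Function.Periodic P (T * I)) (x : ℝ) :
    ∫ y in (0 : ℝ)..T, P (x + y * I) = (∫ y in (0 : ℝ)..T, P (y * I)) +
      ∫ s in (0 : ℝ)..x, ∫ y in (0 : ℝ)..T, 2 * dbar P (s + y * I) := by
  have hdbar (z : ℂ) : I • fderiv ℝ P z 1 - fderiv ℝ P z I = I * (2 * dbar P z) := by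
    rw [dbar, smul_eq_mul]
    linear_combination fderiv ℝ P z I * -I_mul_I
  have green := integral_boundary_rect_of_differentiableOn_real P 0 (x + T * I)
    hP.differentiableOn (by
      simp only [hdbar]
      exact (Continuous.continuousOn (by fun_prop)).integrableOn_compact
        (isCompact_uIcc.reProdIm isCompact_uIcc))
  simp only [hdbar] at green
  simp only [zero_re, zero_im, add_re, add_im, ofReal_re, ofReal_im, mul_re, mul_im, I_re,
    I_im, mul_zero, mul_one, add_zero, zero_add, ofReal_zero, zero_mul, hT _, sub_self,
    smul_eq_mul, intervalIntegral.integral_const_mul, ← mul_sub] at green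
  simp only [intervalIntegral.integral_const_mul]
  linear_combination mul_left_cancel₀ I_ne_zero green

end Wirtinger

section Curve

variable {E : Type*} [NormedAddCommGroup E] [InnerProductSpace ℂ E] {F G : ℂ → E}

/-- The pullback of the Fubini–Study form under the holomorphic curve `z ↦ [F z]`, as the density
`∂∂̄ log ‖F‖²`; the normalization of the metric only enters through a constant factor. -/
noncomputable def fubiniStudyDensity (F : ℂ → E) (z : ℂ) : ℝ :=
  (‖F z‖ ^ 2 * ‖deriv F z‖ ^ 2 - ‖inner ℂ (F z) (deriv F z)‖ ^ 2) / ‖F z‖ ^ 4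

/-- The Wirtinger derivative `∂ log ‖F‖²` of a nowhere vanishing holomorphic curve `F`, the
intermediate step between `log ‖F‖` and the density `∂∂̄ log ‖F‖²`. -/
noncomputable def logNormSqDeriv (F : ℂ → E) (z : ℂ) : ℂ :=
  inner ℂ (F z) (deriv F z) / inner ℂ (F z) (F z)

theorem fubiniStudyDensity_nonneg (F : ℂ → E) (z : ℂ) : 0 ≤ fubiniStudyDensity F z := by
  refine div_nonneg (sub_nonneg.2 ?_) (by positivity)
  rw [← mul_pow]
  gcongr
  exact norm_inner_le_norm _ _

theorem fubiniStudyDensity_le (F : ℂ → E) (z : ℂ) :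
    fubiniStudyDensity F z ≤ (‖deriv F z‖ / ‖F z‖) ^ 2 := by
  rcases eq_or_ne ‖F z‖ 0 with h | h
  · simp [fubiniStudyDensity, h]
  calc fubiniStudyDensity F z ≤ ‖F z‖ ^ 2 * ‖deriv F z‖ ^ 2 / ‖F z‖ ^ 4 := by
        unfold fubiniStudyDensity
        gcongr
        exact sub_le_self _ (sq_nonneg _)
    _ = (‖deriv F z‖ / ‖F z‖) ^ 2 := by field_simp

theorem dbar_inner (hF : Differentiable ℂ F) (hG : Differentiable ℂ G) (z : ℂ) :
    dbar (fun z => inner ℂ (F z) (G z)) z = inner ℂ (deriv F z) (G z) := by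
  have hfderiv {H : ℂ → E} (hH : Differentiable ℂ H) (v : ℂ) :
      fderiv ℝ H z v = v • deriv H z := by
    rw [(hH z).fderiv_restrictScalars ℝ, ContinuousLinearMap.coe_restrictScalars',
      fderiv_eq_smul_deriv]
  simp only [dbar, fderiv_inner_apply ℂ (hF.restrictScalars ℝ z) (hG.restrictScalars ℝ z),
    hfderiv hF, hfderiv hG, inner_smul_left, inner_smul_right, conj_I, map_one]
  linear_combination (inner ℂ (F z) (deriv G z) - inner ℂ (deriv F z) (G z)) * I_mul_I / 2

theorem fubiniStudyDensity_comp {φ : ℂ → ℂ} {z : ℂ} (hF : DifferentiableAt ℂ F (φ z))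
    (hφ : DifferentiableAt ℂ φ z) :
    fubiniStudyDensity (F ∘ φ) z = ‖deriv φ z‖ ^ 2 * fubiniStudyDensity F (φ z) := by
  simp only [fubiniStudyDensity, deriv.scomp z hF hφ, Function.comp_apply, norm_smul,
    inner_smul_right, norm_mul]
  ring

theorem ofReal_fubiniStudyDensity (F : ℂ → E) (z : ℂ) :
    (fubiniStudyDensity F z : ℂ) =
      (inner ℂ (F z) (F z) * inner ℂ (deriv F z) (deriv F z) -
        inner ℂ (F z) (deriv F z) * inner ℂ (deriv F z) (F z)) / inner ℂ (F z) (F z) ^ 2 := by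
  rw [← inner_conj_symm (deriv F z) (F z), mul_conj', inner_self_eq_norm_sq_to_K,
    inner_self_eq_norm_sq_to_K, fubiniStudyDensity]
  push_cast
  rw [← pow_mul]
  rfl

theorem hasDerivAt_log_norm (hF : Differentiable ℂ F) (hF0 : ∀ z, F z ≠ 0) (x y : ℝ) :
    HasDerivAt (fun s : ℝ => Real.log ‖F (s + y * I)‖) (logNormSqDeriv F (x + y * I)).re x := by
  set z : ℂ := x + y * I
  have hline : HasDerivAt (fun s : ℝ => F (s + y * I)) (deriv F z) x := by
    simpa using! (hF z).hasDerivAt.scomp x (ofRealCLM.hasDerivAt.add_const (y * I))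
  have hsq : HasDerivAt (fun s : ℝ => ‖F (s + y * I)‖ ^ 2)
      (2 * (inner ℂ (F z) (deriv F z)).re) x := by
    convert! reCLM.hasFDerivAt.comp_hasDerivAt x (hline.inner ℂ hline) using 1
    · ext s
      exact (inner_self_eq_norm_sq (𝕜 := ℂ) _).symm
    · rw [reCLM_apply, add_re, ← inner_conj_symm (deriv F z), conj_re]
      exact two_mul _
  have hlog := (hsq.log (pow_ne_zero 2 (norm_ne_zero_iff.2 (hF0 z)))).div_const 2
  simp only [Real.log_pow, Nat.cast_ofNat, mul_div_cancel_left₀ _ (two_ne_zero' ℝ)] at hlog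
  convert! hlog using 1
  have hself : inner ℂ (F z) (F z) = (‖F z‖ ^ 2 : ℝ) :=
    (inner_self_eq_norm_sq_to_K _).trans (ofReal_pow _ _).symm
  rw [logNormSqDeriv, hself, div_ofReal_re]
  ring

theorem periodic_logNormSqDeriv {c : ℂ} (hF : Function.Periodic F c) :
    Function.Periodic (logNormSqDeriv F) c := by
  intro z
  have : deriv F (z + c) = deriv F z := by rw [← deriv_comp_add_const, hF.funext]
  rw [logNormSqDeriv, this, hF, logNormSqDeriv]

variable [CompleteSpace E]

theorem differentiable_logNormSqDeriv (hF : Differentiable ℂ F) (hF0 : ∀ z, F z ≠ 0) :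
    Differentiable ℝ (logNormSqDeriv F) := by
  have hF' := hF.deriv.restrictScalars ℝ
  replace hF := hF.restrictScalars ℝ
  have hdiv : logNormSqDeriv F =
      fun z => inner ℂ (F z) (deriv F z) * (inner ℂ (F z) (F z))⁻¹ := rfl
  rw [hdiv]
  exact (hF.inner ℂ hF').fun_mul
    ((hF.inner ℂ hF).fun_inv fun z => inner_self_ne_zero.2 (hF0 z))

theorem dbar_logNormSqDeriv (hF : Differentiable ℂ F) (hF0 : ∀ z, F z ≠ 0) (z : ℂ) :
    dbar (logNormSqDeriv F) z = fubiniStudyDensity F z := by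
  have hFℝ := hF.restrictScalars ℝ
  have hne (z : ℂ) : inner ℂ (F z) (F z) ≠ 0 := inner_self_ne_zero.2 (hF0 z)
  have hprod := dbar_mul (differentiable_logNormSqDeriv hF hF0 z) (hFℝ.inner ℂ hFℝ z)
  have hcancel : (fun z => logNormSqDeriv F z * inner ℂ (F z) (F z)) =
      fun z => inner ℂ (F z) (deriv F z) := funext fun z => div_mul_cancel₀ _ (hne z)
  rw [hcancel, dbar_inner hF hF, dbar_inner hF hF.deriv, logNormSqDeriv,
    div_mul_eq_mul_div, div_add' _ _ _ (hne z), eq_div_iff (hne z)] at hprod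
  rw [ofReal_fubiniStudyDensity, eq_div_iff (pow_ne_zero 2 (hne z))]
  linear_combination -hprod

theorem continuous_fubiniStudyDensity (hF : Differentiable ℂ F) (hF0 : ∀ z, F z ≠ 0) :
    Continuous (fubiniStudyDensity F) := by
  have hF' := hF.deriv.continuous
  have := hF.continuous
  unfold fubiniStudyDensity
  exact Continuous.div (by fun_prop) (by fun_prop) fun z =>
    pow_ne_zero 4 (norm_ne_zero_iff.2 (hF0 z))

theorem integral_log_norm_vertical (hF : Differentiable ℂ F) (hF0 : ∀ z, F z ≠ 0) (T x : ℝ) :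
    ∫ y in (0 : ℝ)..T, Real.log ‖F (x + y * I)‖ =
      (∫ y in (0 : ℝ)..T, Real.log ‖F (y * I)‖) +
        ∫ s in (0 : ℝ)..x, (∫ y in (0 : ℝ)..T, logNormSqDeriv F (s + y * I)).re := by
  have hP := (differentiable_logNormSqDeriv hF hF0).continuous
  have hlog : Continuous fun z => Real.log ‖F z‖ :=
    hF.continuous.norm.log fun z => norm_ne_zero_iff.2 (hF0 z)
  have hre (s : ℝ) : (∫ y in (0 : ℝ)..T, logNormSqDeriv F (s + y * I)).re =
      ∫ y in (0 : ℝ)..T, (logNormSqDeriv F (s + y * I)).re :=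
    (reCLM.intervalIntegral_comp_comm
      (Continuous.intervalIntegrable (by fun_prop) _ _)).symm
  have hftc (y : ℝ) : ∫ s in (0 : ℝ)..x, (logNormSqDeriv F (s + y * I)).re =
      Real.log ‖F (x + y * I)‖ - Real.log ‖F (y * I)‖ := by
    simpa using intervalIntegral.integral_eq_sub_of_hasDerivAt
      (fun s _ => hasDerivAt_log_norm hF hF0 s y)
      (Continuous.intervalIntegrable (by fun_prop) 0 x)
  have hswap : IntegrableOn (Function.uncurry fun s y : ℝ => (logNormSqDeriv F (s + y * I)).re)
      (Set.uIoc 0 x ×ˢ Set.uIoc 0 T) := by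
    refine (ContinuousOn.integrableOn_compact (isCompact_uIcc.prod isCompact_uIcc)
      (Continuous.continuousOn ?_)).mono_set
      (Set.prod_mono Set.uIoc_subset_uIcc Set.uIoc_subset_uIcc)
    unfold Function.uncurry
    fun_prop
  simp only [hre]
  rw [MeasureTheory.intervalIntegral_intervalIntegral_swap hswap]
  simp only [hftc]
  rw [intervalIntegral.integral_sub
    (Continuous.intervalIntegrable (hlog.comp' (by fun_prop)) _ _)
    (Continuous.intervalIntegrable (hlog.comp' (by fun_prop)) _ _)]
  exact (add_sub_cancel _ _).symm

theorem norm_le_mul_exp_of_eq_add_integral {V : Type*} [NormedAddCommGroup V] [NormedSpace ℝ V]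
    {Q H : ℝ → V} {A q : ℝ} (hq : 0 < q) (hQ : ∀ x, Q x = Q 0 + ∫ s in (0 : ℝ)..x, H s)
    (hH : ∀ s, 0 ≤ s → ‖H s‖ ≤ A * Real.exp (q * s)) {x : ℝ} (hx : 0 ≤ x) :
    ‖Q x‖ ≤ (‖Q 0‖ + A / q) * Real.exp (q * x) := by
  have hA : 0 ≤ A := by simpa using (norm_nonneg _).trans (hH 0 le_rfl)
  have hint : ‖∫ s in (0 : ℝ)..x, H s‖ ≤ A / q * Real.exp (q * x) :=
    calc ‖∫ s in (0 : ℝ)..x, H s‖ ≤ ∫ s in (0 : ℝ)..x, A * Real.exp (q * s) :=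
          intervalIntegral.norm_integral_le_of_norm_le hx
            (ae_of_all _ fun s hs => hH s hs.1.le)
            (Continuous.intervalIntegrable (by fun_prop) _ _)
      _ = A / q * (Real.exp (q * x) - 1) := by
          simp [intervalIntegral.integral_comp_mul_left _ hq.ne']
          ring
      _ ≤ A / q * Real.exp (q * x) := by
          gcongr
          exact sub_le_self _ zero_le_one
  calc ‖Q x‖ ≤ ‖Q 0‖ * 1 + A / q * Real.exp (q * x) := by
        rw [hQ, mul_one]
        exact (norm_add_le _ _).trans (add_le_add_right hint _)
    _ ≤ ‖Q 0‖ * Real.exp (q * x) + A / q * Real.exp (q * x) := by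
        gcongr
        exact Real.one_le_exp (by positivity)
    _ = _ := (add_mul _ _ _).symm

theorem exists_integral_log_norm_le_mul_exp (hF : Differentiable ℂ F) (hF0 : ∀ z, F z ≠ 0) {T : ℝ}
    (hT0 : 0 ≤ T) (hT : Function.Periodic F (T * I)) {C q : ℝ} (hq : 0 < q)
    (hC : ∀ z : ℂ, 0 ≤ z.re → fubiniStudyDensity F z ≤ C * Real.exp (q * z.re)) :
    ∃ A : ℝ, ∀ x : ℝ, 0 ≤ x →
      ∫ y in (0 : ℝ)..T, Real.log ‖F (x + y * I)‖ ≤ A * Real.exp (q * x) := by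
  have hdbar : dbar (logNormSqDeriv F) = fun z => (fubiniStudyDensity F z : ℂ) :=
    funext (dbar_logNormSqDeriv hF hF0)
  have hdensity (s : ℝ) (hs : 0 ≤ s) :
      ‖∫ y in (0 : ℝ)..T, 2 * dbar (logNormSqDeriv F) (s + y * I)‖ ≤
        2 * C * T * Real.exp (q * s) := by
    have := intervalIntegral.norm_integral_le_of_norm_le_const (a := 0) (b := T)
      (f := fun y : ℝ => 2 * dbar (logNormSqDeriv F) (s + y * I)) (C := 2 * (C * Real.exp (q * s)))
      fun y _ => by
        rw [hdbar, norm_mul, Complex.norm_two, norm_real,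
          Real.norm_of_nonneg (fubiniStudyDensity_nonneg _ _)]
        gcongr
        simpa using hC (s + y * I) (by simpa using hs)
    rw [sub_zero, abs_of_nonneg hT0] at this
    linarith
  obtain ⟨B, hB⟩ : ∃ B, ∀ s : ℝ, 0 ≤ s →
      ‖∫ y in (0 : ℝ)..T, logNormSqDeriv F (s + y * I)‖ ≤ B * Real.exp (q * s) :=
    ⟨_, fun s hs => norm_le_mul_exp_of_eq_add_integral hq
      (Q := fun x : ℝ => ∫ y in (0 : ℝ)..T, logNormSqDeriv F (x + y * I))
      (fun x => by
        simpa using integral_vertical_eq_add_integral_dbar (differentiable_logNormSqDeriv hF hF0)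
          (by rw [hdbar]; exact continuous_ofReal.comp (continuous_fubiniStudyDensity hF hF0))
          (periodic_logNormSqDeriv hT) x) hdensity hs⟩
  exact ⟨_, fun x hx => (Real.le_norm_self _).trans <| norm_le_mul_exp_of_eq_add_integral hq
    (Q := fun x : ℝ => ∫ y in (0 : ℝ)..T, Real.log ‖F (x + y * I)‖)
    (fun x => by simpa using integral_log_norm_vertical hF hF0 T x)
    (fun s hs => (abs_re_le_norm _).trans (hB s hs)) hx⟩

theorem exists_circleAverage_log_norm_le (hF : Differentiable ℂ F) (hF0 : ∀ z, F z ≠ 0) {C : ℝ}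
    {k : ℕ} (hC : ∀ z : ℂ, 1 ≤ ‖z‖ → fubiniStudyDensity F z ≤ C * ‖z‖ ^ k) :
    ∃ A : ℝ, ∀ r : ℝ, 1 ≤ r →
      Real.circleAverage (fun z => Real.log ‖F z‖) 0 r ≤ A * r ^ (k + 2) := by
  have hdensity (w : ℂ) (hw : 0 ≤ w.re) :
      fubiniStudyDensity (F ∘ exp) w ≤ C * Real.exp ((k + 2 : ℕ) * w.re) := by
    rw [fubiniStudyDensity_comp (hF _) differentiableAt_exp, Complex.deriv_exp,
      Real.exp_nat_mul, ← norm_exp, pow_add, ← mul_assoc, mul_comm (_ * _)]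
    gcongr
    exact hC _ (by rw [norm_exp]; exact Real.one_le_exp hw)
  obtain ⟨A, hA⟩ := exists_integral_log_norm_le_mul_exp (hF.comp differentiable_exp)
    (fun w => hF0 (exp w)) Real.two_pi_pos.le
    (fun w => congrArg F (by simpa using exp_periodic w)) (by positivity) hdensity
  refine ⟨(2 * π)⁻¹ * A, fun r hr => ?_⟩
  have hr0 : 0 < r := zero_lt_one.trans_le hr
  have hcircle (θ : ℝ) : exp (Real.log r + θ * I) = circleMap 0 r θ := by
    rw [exp_add, ← ofReal_exp, Real.exp_log hr0, circleMap_zero]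
  have hAr := hA (Real.log r) (Real.log_nonneg hr)
  simp only [Function.comp_apply, hcircle, Real.exp_nat_mul, Real.exp_log hr0] at hAr
  rw [Real.circleAverage_def, smul_eq_mul, mul_assoc]
  gcongr

end Curve

section Entire

variable {g : ℂ → ℂ} {U : ℂ → ℝ}

theorem re_le_mul_circleAverage {c w : ℂ} {R : ℝ} (hg : DiffContOnCl ℂ g (Metric.ball c R))
    (hU : CircleIntegrable U c R) (hU0 : ∀ z ∈ Metric.sphere c R, 0 ≤ U z)
    (hgU : ∀ z ∈ Metric.sphere c R, (g z).re ≤ U z) (hw : w ∈ Metric.ball c R) :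
    (g w).re ≤ (R + ‖w - c‖) / (R - ‖w - c‖) * Real.circleAverage U c R := by
  have hR : 0 < R := Metric.pos_of_mem_ball hw
  set k : ℂ → ℝ := fun z => ((z - c + (w - c)) / (z - c - (w - c))).re
  have hgc : ContinuousOn g (Metric.sphere c R) :=
    hg.continuousOn_ball.mono Metric.sphere_subset_closedBall
  have hk : ContinuousOn k (Metric.sphere c R) := by
    have := continuousOn_herglotzRieszKernel_sphere hw
    rw [abs_of_pos hR] at this
    exact continuous_re.comp_continuousOn this
  have hint : CircleIntegrable (fun z => k z • g z) c R :=
    (hk.smul hgc).circleIntegrable hR.le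
  calc (g w).re = Real.circleAverage (fun z => k z * (g z).re) c R := by
        rw [← hg.circleAverage_re_herglotzRieszKernel_smul' hw]
        refine (reCLM.circleAverage_comp_comm hint).symm.trans ?_
        congr 1 with z
        simp
    _ ≤ Real.circleAverage (fun z => (R + ‖w - c‖) / (R - ‖w - c‖) * U z) c R := by
        refine Real.circleAverage_mono
          ((hk.mul (continuous_re.comp_continuousOn hgc)).circleIntegrable hR.le)
          (hU.const_smul (a := (R + ‖w - c‖) / (R - ‖w - c‖))) fun z hz => ?_
        rw [abs_of_pos hR] at hz
        have hk0 : 0 ≤ k z := (div_nonneg (sub_nonneg.2 (mem_ball_iff_norm.1 hw).le)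
          (by positivity)).trans (le_re_herglotzRieszKernel hz hw)
        exact (mul_le_mul_of_nonneg_left (hgU z hz) hk0).trans
          (mul_le_mul_of_nonneg_right (re_herglotzRieszKernel_le hz hw) (hU0 z hz))
    _ = (R + ‖w - c‖) / (R - ‖w - c‖) * Real.circleAverage U c R := by
        simp only [← smul_eq_mul, Real.circleAverage_fun_smul]

theorem norm_le_of_forall_re_le {M : ℝ} {z : ℂ} (hz : z ≠ 0) (hM : 0 < M) (hg : Differentiable ℂ g)
    (hre : ∀ w : ℂ, ‖w‖ < 2 * ‖z‖ → (g w).re ≤ M) : ‖g z‖ ≤ 2 * M + 3 * ‖g 0‖ := by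
  have hz0 : 0 < ‖z‖ := norm_pos_iff.2 hz
  refine (borelCaratheodory hM hg.differentiableOn
    (fun w hw => hre w (mem_ball_zero_iff.1 hw)) (by positivity)
    (mem_ball_zero_iff.2 (by linarith))).trans_eq ?_
  field_simp
  ring

theorem iteratedDeriv_eq_zero_of_norm_le {B : ℝ} {K k : ℕ} (hg : Differentiable ℂ g)
    (hB : ∀ z : ℂ, 1 ≤ ‖z‖ → ‖g z‖ ≤ B * ‖z‖ ^ K) (hk : K < k) : iteratedDeriv k g 0 = 0 := by
  have hcauchy : ∀ᶠ R : ℝ in atTop,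
      ‖iteratedDeriv k g 0‖ ≤ k.factorial * B * (R ^ K / R ^ k) := by
    filter_upwards [eventually_ge_atTop 1] with R hR
    have hsphere (z : ℂ) (hz : z ∈ Metric.sphere 0 R) : ‖g z‖ ≤ B * R ^ K := by
      rw [← mem_sphere_zero_iff_norm.1 hz] at hR ⊢
      exact hB z hR
    calc ‖iteratedDeriv k g 0‖ ≤ k.factorial * (B * R ^ K) / R ^ k :=
          norm_iteratedDeriv_le_of_forall_mem_sphere_norm_le k (by positivity) hg.diffContOnCl
            hsphere
      _ = k.factorial * B * (R ^ K / R ^ k) := by ring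
  have hlim := (tendsto_pow_div_pow_atTop_zero (𝕜 := ℝ) hk).const_mul (k.factorial * B)
  rw [mul_zero] at hlim
  exact norm_le_zero_iff.1 (ge_of_tendsto hlim hcauchy)

theorem exists_polynomial_of_norm_le {B : ℝ} {K : ℕ} (hg : Differentiable ℂ g)
    (hB : ∀ z : ℂ, 1 ≤ ‖z‖ → ‖g z‖ ≤ B * ‖z‖ ^ K) :
    ∃ p : Polynomial ℂ, ∀ z, g z = p.eval z := by
  refine ⟨∑ k ∈ Finset.range (K + 1),
    Polynomial.monomial k ((k.factorial : ℂ)⁻¹ * iteratedDeriv k g 0), fun z => ?_⟩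
  rw [← taylorSeries_eq_of_entire' 0 z hg, Polynomial.eval_finsetSum,
    tsum_eq_sum (s := Finset.range (K + 1)) fun k hk => by
      rw [iteratedDeriv_eq_zero_of_norm_le hg hB (by simpa using hk), mul_zero, zero_mul]]
  simp

theorem exists_polynomial_of_circleAverage_le {A : ℝ} {K : ℕ} (hg : Differentiable ℂ g)
    (hU : Continuous U) (hU0 : ∀ z, 0 ≤ U z) (hgU : ∀ z, (g z).re ≤ U z)
    (hA : ∀ r : ℝ, 1 ≤ r → Real.circleAverage U 0 r ≤ A * r ^ K) :
    ∃ p : Polynomial ℂ, ∀ z, g z = p.eval z := by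
  have hA0 : 0 ≤ A := by
    simpa using (Real.circleAverage_nonneg_of_nonneg fun z _ => hU0 z).trans (hA 1 le_rfl)
  refine exists_polynomial_of_norm_le (B := 6 * A * 4 ^ K + 2 + 3 * ‖g 0‖) (K := K) hg
    fun z hz => ?_
  have hre (w : ℂ) (hw : ‖w‖ < 2 * ‖z‖) : (g w).re ≤ 3 * A * (4 * ‖z‖) ^ K + 1 := by
    have hfactor : (4 * ‖z‖ + ‖w‖) / (4 * ‖z‖ - ‖w‖) ≤ 3 := by
      rw [div_le_iff₀ (by linarith)]
      linarith
    have hpoisson := re_le_mul_circleAverage (c := 0) (R := 4 * ‖z‖) hg.diffContOnCl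
      (hU.continuousOn.circleIntegrable (by positivity)) (fun z _ => hU0 z) (fun z _ => hgU z)
      (mem_ball_zero_iff.2 (show ‖w‖ < 4 * ‖z‖ by linarith))
    rw [sub_zero] at hpoisson
    calc (g w).re ≤ 3 * (A * (4 * ‖z‖) ^ K) := hpoisson.trans <|
          mul_le_mul hfactor (hA _ (by linarith))
            (Real.circleAverage_nonneg_of_nonneg fun z _ => hU0 z) zero_le_three
      _ ≤ 3 * A * (4 * ‖z‖) ^ K + 1 := by linarith
  have hz0 : z ≠ 0 := norm_pos_iff.1 (by positivity)
  calc ‖g z‖ ≤ 2 * (3 * A * (4 * ‖z‖) ^ K + 1) + 3 * ‖g 0‖ :=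
        norm_le_of_forall_re_le hz0 (by positivity) hg hre
    _ = 6 * A * 4 ^ K * ‖z‖ ^ K + (2 + 3 * ‖g 0‖) * 1 := by rw [mul_pow]; ring
    _ ≤ 6 * A * 4 ^ K * ‖z‖ ^ K + (2 + 3 * ‖g 0‖) * ‖z‖ ^ K := by
        gcongr
        exact one_le_pow₀ hz
    _ = (6 * A * 4 ^ K + 2 + 3 * ‖g 0‖) * ‖z‖ ^ K := by ring

theorem exists_entire_log (hg : Differentiable ℂ g) (hg0 : ∀ z, g z ≠ 0) :
    ∃ l : ℂ → ℂ, Differentiable ℂ l ∧ ∀ z, g z = exp (l z) := by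
  have hdlog : Differentiable ℂ fun z => deriv g z / g z :=
    hg.deriv.fun_div hg hg0
  obtain ⟨l, hl0, hl⟩ := hdlog.isExactOn_univ.with_val_at 0 (log (g 0))
  replace hl (z : ℂ) : HasDerivAt l (deriv g z / g z) z := hl z (Set.mem_univ z)
  refine ⟨l, fun z => (hl z).differentiableAt, fun z => ?_⟩
  have hquot (z : ℂ) : HasDerivAt (fun z => g z * exp (-l z)) 0 z := by
    convert! (hg z).hasDerivAt.fun_mul (hl z).fun_neg.cexp using 1
    field_simp [hg0 z]
    ring
  have hconst := is_const_of_deriv_eq_zero (fun z => (hquot z).differentiableAt)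
    (fun z => (hquot z).deriv) z 0
  rw [hl0, exp_neg, exp_neg, exp_log (hg0 0), mul_inv_cancel₀ (hg0 0)] at hconst
  exact eq_of_div_eq_one hconst

end Entire

section Lagrange

variable {ι : Type*} [Fintype ι]

theorem two_mul_norm_sq_mul_norm_sq_sub_norm_inner_sq (x y : EuclideanSpace ℂ ι) :
    2 * (‖x‖ ^ 2 * ‖y‖ ^ 2 - ‖inner ℂ x y‖ ^ 2) = ∑ i, ∑ j, ‖x i * y j - x j * y i‖ ^ 2 := by
  have hinner : ‖inner ℂ x y‖ ^ 2 = ∑ i, ∑ j, (x i * y j * conj (x j * y i)).re := by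
    rw [← ofReal_re (_ ^ 2), ofReal_pow, ← mul_conj', PiLp.inner_apply, map_sum,
      Finset.sum_mul_sum, Finset.sum_comm, re_sum]
    refine Finset.sum_congr rfl fun i _ => (re_sum _ _).trans <| Finset.sum_congr rfl fun j _ => ?_
    simp only [RCLike.inner_apply, map_mul, conj_conj]
    ring_nf
  have hterm (i j : ι) : ‖x i * y j - x j * y i‖ ^ 2 = ‖x i‖ ^ 2 * ‖y j‖ ^ 2 +
      ‖y i‖ ^ 2 * ‖x j‖ ^ 2 - 2 * (x i * y j * conj (x j * y i)).re := by
    rw [Complex.sq_norm, normSq_sub, ← Complex.sq_norm, ← Complex.sq_norm, norm_mul, norm_mul]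
    ring
  simp only [hterm, Finset.sum_add_distrib, Finset.sum_sub_distrib, ← Finset.mul_sum, hinner,
    ← Finset.sum_mul, ← EuclideanSpace.norm_sq_eq]
  ring

theorem two_mul_sum_mul_sum_compl_mul_le [DecidableEq ι] {w : ι → ℝ} (hw : ∀ i, 0 ≤ w i)
    {q : ι → ι → ℝ} (hq : ∀ i j, 0 ≤ q i j) (hsymm : ∀ i j, q i j = q j i) {A : Finset ι} {c : ℝ}
    (hc : ∀ i ∈ A, ∀ j ∉ A, c ≤ q i j) :
    2 * ((∑ i ∈ A, w i) * (∑ j ∈ Aᶜ, w j) * c) ≤ ∑ i, ∑ j, w i * w j * q i j := by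
  have hblock (B : Finset ι) (hB : ∀ i ∈ B, ∀ j ∉ B, c ≤ q i j) :
      (∑ i ∈ B, w i) * (∑ j ∈ Bᶜ, w j) * c ≤ ∑ i ∈ B, ∑ j, w i * w j * q i j := by
    rw [Finset.sum_mul_sum, Finset.sum_mul]
    refine Finset.sum_le_sum fun i hi => ?_
    calc (∑ j ∈ Bᶜ, w i * w j) * c ≤ ∑ j ∈ Bᶜ, w i * w j * q i j := by
          rw [Finset.sum_mul]
          exact Finset.sum_le_sum fun j hj => mul_le_mul_of_nonneg_left
            (hB i hi j (Finset.mem_compl.1 hj)) (mul_nonneg (hw i) (hw j))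
      _ ≤ ∑ j, w i * w j * q i j :=
          Finset.sum_le_sum_of_subset_of_nonneg (Finset.subset_univ _) fun j _ _ =>
            mul_nonneg (mul_nonneg (hw i) (hw j)) (hq i j)
  have hA := hblock A hc
  have hAc := hblock Aᶜ fun i hi j hj =>
    hsymm i j ▸ hc j (by simpa using hj) i (Finset.mem_compl.1 hi)
  rw [compl_compl] at hAc
  rw [← Finset.sum_add_sum_compl A]
  linarith

end Lagrange

section ExpCurve

variable {ι : Type*} {g : ι → ℂ → ℂ} {z : ℂ}

/-- The curve `z ↦ (exp (g i z))ᵢ`, the lift to affine space of a curve in the torus of projective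
space whose homogeneous coordinates are the exponentials of the `g i`. -/
noncomputable def expCurve (g : ι → ℂ → ℂ) (z : ℂ) : EuclideanSpace ℂ ι :=
  WithLp.toLp 2 fun i => exp (g i z)

theorem expCurve_ne_zero [Nonempty ι] (g : ι → ℂ → ℂ) (z : ℂ) : expCurve g z ≠ 0 := fun h =>
  exp_ne_zero (g (Classical.arbitrary ι) z) (congrFun (congrArg WithLp.ofLp h) _)

/-- The part of `‖expCurve g z‖²` carried by the coordinates in `B`; the density is large where a
set of coordinates and its complement have equal mass. -/
noncomputable def mass (g : ι → ℂ → ℂ) (B : Finset ι) (z : ℂ) : ℝ :=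
  ∑ i ∈ B, ‖exp (g i z)‖ ^ 2

theorem continuous_mass (hg : ∀ i, Continuous (g i)) (B : Finset ι) : Continuous (mass g B) :=
  continuous_finsetSum _ fun i _ => ((continuous_exp.comp (hg i)).norm).pow 2

theorem sq_norm_exp_le_mass {B : Finset ι} {i : ι} (hi : i ∈ B) :
    ‖exp (g i z)‖ ^ 2 ≤ mass g B z :=
  Finset.single_le_sum (f := fun i => ‖exp (g i z)‖ ^ 2) (fun _ _ => sq_nonneg _) hi

variable [Fintype ι]

theorem norm_expCurve_sq (g : ι → ℂ → ℂ) (z : ℂ) :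
    ‖expCurve g z‖ ^ 2 = mass g Finset.univ z := EuclideanSpace.norm_sq_eq _

theorem hasDerivAt_expCurve (hg : ∀ i, DifferentiableAt ℂ (g i) z) :
    HasDerivAt (expCurve g) (WithLp.toLp 2 fun i => exp (g i z) * deriv (g i) z) z := by
  unfold expCurve
  exact (PiLp.hasFDerivAt_toLp 2 _).comp_hasDerivAt z
    (hasDerivAt_pi.2 fun i => (hg i).hasDerivAt.cexp)

theorem fubiniStudyDensity_expCurve (hg : ∀ i, DifferentiableAt ℂ (g i) z) :
    fubiniStudyDensity (expCurve g) z =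
      (∑ i, ∑ j, ‖exp (g i z)‖ ^ 2 * ‖exp (g j z)‖ ^ 2 * ‖deriv (g i) z - deriv (g j) z‖ ^ 2) /
        (2 * mass g Finset.univ z ^ 2) := by
  have hlagrange := two_mul_norm_sq_mul_norm_sq_sub_norm_inner_sq (expCurve g z)
    (WithLp.toLp 2 fun i => exp (g i z) * deriv (g i) z)
  have hterm (i j : ι) : ‖exp (g i z) * (exp (g j z) * deriv (g j) z) -
      exp (g j z) * (exp (g i z) * deriv (g i) z)‖ ^ 2 =
      ‖exp (g i z)‖ ^ 2 * ‖exp (g j z)‖ ^ 2 * ‖deriv (g i) z - deriv (g j) z‖ ^ 2 := by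
    rw [norm_sub_rev (deriv (g i) z), ← mul_pow, ← mul_pow, ← norm_mul, ← norm_mul]
    ring_nf
  simp only [expCurve, hterm] at hlagrange
  rw [fubiniStudyDensity, (hasDerivAt_expCurve hg).deriv, ← norm_expCurve_sq, ← pow_mul,
    ← hlagrange, mul_div_mul_left _ _ two_ne_zero]
  rfl

theorem div_four_le_fubiniStudyDensity_expCurve [Nonempty ι] [DecidableEq ι]
    (hg : ∀ i, DifferentiableAt ℂ (g i) z) {A : Finset ι} (hA : mass g A z = mass g Aᶜ z) {c : ℝ}
    (hc : ∀ i ∈ A, ∀ j ∉ A, c ≤ ‖deriv (g i) z - deriv (g j) z‖ ^ 2) :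
    c / 4 ≤ fubiniStudyDensity (expCurve g) z := by
  have hsum := two_mul_sum_mul_sum_compl_mul_le (w := fun i => ‖exp (g i z)‖ ^ 2)
    (q := fun i j => ‖deriv (g i) z - deriv (g j) z‖ ^ 2) (fun _ => sq_nonneg _)
    (fun _ _ => sq_nonneg _) (fun _ _ => by rw [norm_sub_rev]) hc
  have hpos : 0 < mass g Finset.univ z := by
    rw [← norm_expCurve_sq]
    exact pow_pos (norm_pos_iff.2 (expCurve_ne_zero g z)) 2
  have huniv : mass g Finset.univ z = 2 * mass g A z := by
    rw [two_mul]
    nth_rw 2 [hA]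
    exact (Finset.sum_add_sum_compl A _).symm
  change 2 * (mass g A z * mass g Aᶜ z * c) ≤ _ at hsum
  rw [fubiniStudyDensity_expCurve hg, le_div_iff₀ (by positivity)]
  refine le_trans (le_of_eq ?_) hsum
  rw [huniv, ← hA]
  ring

theorem fubiniStudyDensity_expCurve_le (hg : ∀ i, DifferentiableAt ℂ (g i) z) {D : ℝ}
    (hD : ∀ i, ‖deriv (g i) z‖ ≤ D) : fubiniStudyDensity (expCurve g) z ≤ D ^ 2 := by
  refine (fubiniStudyDensity_le _ z).trans ?_
  rw [(hasDerivAt_expCurve hg).deriv, div_pow]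
  refine div_le_of_le_mul₀ (sq_nonneg _) (sq_nonneg _) ?_
  rw [EuclideanSpace.norm_sq_eq, norm_expCurve_sq, mass, Finset.mul_sum]
  refine Finset.sum_le_sum fun i _ => ?_
  rw [norm_mul, mul_pow, mul_comm]
  gcongr
  exact hD i

theorem re_le_log_norm_expCurve (g : ι → ℂ → ℂ) (i : ι) (z : ℂ) :
    (g i z).re ≤ Real.log ‖expCurve g z‖ := by
  have : Nonempty ι := ⟨i⟩
  rw [Real.le_log_iff_exp_le (norm_pos_iff.2 (expCurve_ne_zero g z)), ← norm_exp]
  exact PiLp.norm_apply_le (expCurve g z) i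

theorem exists_polynomial_of_fubiniStudyDensity_expCurve_le (hg : ∀ i, Differentiable ℂ (g i))
    {i₀ : ι} (h₀ : g i₀ = 0) {C : ℝ} {k : ℕ}
    (hC : ∀ z : ℂ, 1 ≤ ‖z‖ → fubiniStudyDensity (expCurve g) z ≤ C * ‖z‖ ^ k) (i : ι) :
    ∃ p : Polynomial ℂ, ∀ z, g i z = p.eval z := by
  have : Nonempty ι := ⟨i⟩
  have hF : Differentiable ℂ (expCurve g) := fun z =>
    (hasDerivAt_expCurve fun i => hg i z).differentiableAt
  obtain ⟨A, hA⟩ := exists_circleAverage_log_norm_le hF (expCurve_ne_zero g) hC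
  exact exists_polynomial_of_circleAverage_le (hg i)
    (hF.continuous.norm.log fun z => norm_ne_zero_iff.2 (expCurve_ne_zero g z))
    (fun z => by simpa [h₀] using re_le_log_norm_expCurve g i₀ z)
    (re_le_log_norm_expCurve g i) hA

end ExpCurve

section Polynomial

open Polynomial

theorem norm_eval_le_of_natDegree_le {R : Type*} [NormedDivisionRing R] {p : R[X]} {m : ℕ}
    (hp : p.natDegree ≤ m) {z : R} (hz : 1 ≤ ‖z‖) :
    ‖p.eval z‖ ≤ (∑ k ∈ Finset.range (m + 1), ‖p.coeff k‖) * ‖z‖ ^ m := by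
  rw [eval_eq_sum_range' (Nat.lt_succ_of_le hp), Finset.sum_mul]
  refine (norm_sum_le _ _).trans (Finset.sum_le_sum fun k hk => ?_)
  rw [norm_mul, norm_pow]
  gcongr
  exact Nat.lt_succ_iff.1 (Finset.mem_range.1 hk)

theorem eventually_mul_pow_le_norm_eval {R : Type*} [NormedDivisionRing R] {p : R[X]} {m : ℕ}
    (hp : m < p.natDegree) (C : ℝ) : ∀ᶠ z in cobounded R, C * ‖z‖ ^ m ≤ ‖p.eval z‖ := by
  have hlittle := ((isLittleO_cobounded_of_degree_lt (P := X ^ m)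
    ((degree_X_pow m).trans_lt (coe_lt_degree.2 hp))).norm_left.const_mul_left C).bound one_pos
  filter_upwards [hlittle] with z hz
  rw [one_mul, eval_X_pow, norm_pow] at hz
  exact (Real.le_norm_self _).trans hz

theorem tendsto_re_eval_mul_atTop {p : ℂ[X]} {k : ℕ} (hk : k ≠ 0) (hp : p.natDegree ≤ k) {u : ℂ}
    (hu : 0 < (p.coeff k * u ^ k).re) :
    Tendsto (fun r : ℝ => (p.eval (r * u)).re) atTop atTop := by
  set q : ℝ[X] := ∑ l ∈ Finset.range (k + 1), monomial l (p.coeff l * u ^ l).re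
  have hq_eval (r : ℝ) : (p.eval (r * u)).re = q.eval r := by
    rw [eval_eq_sum_range' (Nat.lt_succ_of_le hp), re_sum, eval_finsetSum]
    refine Finset.sum_congr rfl fun l _ => ?_
    rw [eval_monomial, ← re_mul_ofReal, ofReal_pow, mul_pow]
    ring_nf
  have hq_coeff : q.coeff k = (p.coeff k * u ^ k).re := by
    simp [q, coeff_monomial]
  have hq_natDegree : q.natDegree = k := by
    refine natDegree_eq_of_le_of_coeff_ne_zero (natDegree_sum_le_of_forall_le _ _ fun l hl => ?_)
      (hq_coeff ▸ hu.ne')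
    exact (natDegree_monomial_le _).trans (Nat.lt_succ_iff.1 (Finset.mem_range.1 hl))
  simp only [hq_eval]
  refine q.tendsto_atTop_of_leadingCoeff_nonneg
    (natDegree_pos_iff_degree_pos.1 (hq_natDegree ▸ hk.pos)) ?_
  rw [leadingCoeff, hq_natDegree, hq_coeff]
  exact hu.le

end Polynomial

section Degree

open Polynomial

variable {ι : Type*} {p : ι → ℂ[X]} {k : ℕ}

theorem eventually_mass_le_norm_exp_sq (hk : k ≠ 0) (hp : ∀ i, (p i).natDegree ≤ k) {u : ℂ}
    {i : ι} {B : Finset ι}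
    (hu : ∀ j ∈ B, ((p j).coeff k * u ^ k).re < ((p i).coeff k * u ^ k).re) :
    ∀ᶠ r : ℝ in atTop,
      mass (fun j z => (p j).eval z) B (r * u) ≤ ‖exp ((p i).eval (r * u))‖ ^ 2 := by
  have hratio (j : ι) (hj : j ∈ B) :
      Tendsto (fun r : ℝ => ‖exp (-(p i - p j).eval (r * u))‖ ^ 2) atTop (𝓝 0) := by
    have hre := tendsto_re_eval_mul_atTop (p := p i - p j) (u := u) hk
      ((natDegree_sub_le_of_le (hp i) (hp j)).trans_eq (max_self k))
      (by rw [coeff_sub, sub_mul, sub_re]; exact sub_pos.2 (hu j hj))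
    simpa [Function.comp_def, norm_exp] using (Real.tendsto_exp_neg_atTop_nhds_zero.comp hre).pow 2
  have hsum := tendsto_finsetSum B hratio
  rw [Finset.sum_const_zero] at hsum
  filter_upwards [hsum.eventually_le_const one_pos] with r hr
  calc mass (fun j z => (p j).eval z) B (r * u)
      = (∑ j ∈ B, ‖exp (-(p i - p j).eval (r * u))‖ ^ 2) * ‖exp ((p i).eval (r * u))‖ ^ 2 := by
        rw [mass, Finset.sum_mul]
        refine Finset.sum_congr rfl fun j _ => ?_
        rw [← mul_pow, ← norm_mul, ← exp_add, eval_sub]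
        ring_nf
    _ ≤ ‖exp ((p i).eval (r * u))‖ ^ 2 := mul_le_of_le_one_left (sq_nonneg _) hr

theorem re_mul_conj_lt_of_norm_le {a b : ℂ} (hb : ‖b‖ ≤ ‖a‖) (hne : b ≠ a) :
    (b * conj a).re < (a * conj a).re := by
  have hpos : 0 < normSq (b - a) := normSq_pos.2 (sub_ne_zero.2 hne)
  rw [normSq_sub, ← Complex.sq_norm, ← Complex.sq_norm] at hpos
  rw [mul_conj', ← ofReal_pow, ofReal_re]
  linarith [pow_le_pow_left₀ (norm_nonneg b) hb 2]

theorem exists_norm_eq_mass_eq_mass {g : ι → ℂ → ℂ} (hg : ∀ i, Continuous (g i))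
    {A B : Finset ι} {z₁ z₂ : ℂ} (hz : ‖z₁‖ = ‖z₂‖) (h₁ : mass g A z₁ ≤ mass g B z₁)
    (h₂ : mass g B z₂ ≤ mass g A z₂) : ∃ z, ‖z‖ = ‖z₁‖ ∧ mass g A z = mass g B z := by
  have hsphere : IsPreconnected (Metric.sphere (0 : ℂ) ‖z₁‖) :=
    isPreconnected_sphere (by rw [rank_real_complex]; exact Nat.one_lt_ofNat) 0 _
  obtain ⟨z, hz, hAB⟩ := hsphere.intermediate_value₂ (mem_sphere_zero_iff_norm.2 rfl)
    (mem_sphere_zero_iff_norm.2 hz.symm) (continuous_mass hg A).continuousOn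
    (continuous_mass hg B).continuousOn h₁ h₂
  exact ⟨z, mem_sphere_zero_iff_norm.1 hz, hAB⟩

theorem frequently_mass_eq_mass_compl [Fintype ι] [DecidableEq ι] (hk : k ≠ 0)
    (hp : ∀ i, (p i).natDegree ≤ k) {i₀ i₁ : ι} (h₀ : (p i₀).coeff k = 0)
    (h₁ : (p i₁).coeff k ≠ 0) (hmax : ∀ i, ‖(p i).coeff k‖ ≤ ‖(p i₁).coeff k‖) {A : Finset ι}
    (hA : ∀ i, i ∈ A ↔ (p i).coeff k = (p i₁).coeff k) :
    ∃ᶠ z in cobounded ℂ,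
      mass (fun i z => (p i).eval z) A z = mass (fun i z => (p i).eval z) Aᶜ z := by
  set a := (p i₁).coeff k
  -- The top coefficient `a` of the exponents in `A` turns into `‖a‖²` in the direction `u`, and
  -- into `-‖a‖²` in the direction `v`.
  obtain ⟨u, hu⟩ := IsAlgClosed.exists_pow_nat_eq (conj a) hk.pos
  obtain ⟨v, hv⟩ := IsAlgClosed.exists_pow_nat_eq (-conj a) hk.pos
  have hnorm : ‖v‖ = ‖u‖ := by
    rw [← pow_left_inj₀ (norm_nonneg _) (norm_nonneg _) hk, ← norm_pow, ← norm_pow, hu, hv,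
      norm_neg]
  have hu0 : 0 < ‖u‖ := norm_pos_iff.2 fun h => h₁ (by simpa [h, hk] using hu.symm)
  have hA_dominates := eventually_mass_le_norm_exp_sq (u := u) (i := i₁) (B := Aᶜ) hk hp
    fun j hj => by
      rw [hu]
      exact re_mul_conj_lt_of_norm_le (hmax j) fun h => Finset.mem_compl.1 hj ((hA j).2 h)
  have hAc_dominates := eventually_mass_le_norm_exp_sq (u := v) (i := i₀) (B := A) hk hp
    fun j hj => by
      rw [hv, h₀, (hA j).1 hj, mul_neg, mul_conj]
      simpa using h₁
  refine (hasBasis_cobounded_norm (E := ℂ)).frequently_iff.2 fun {R} _ => ?_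
  obtain ⟨r, hr₁, hr₂, hrR, hr0⟩ := (hA_dominates.and (hAc_dominates.and
    ((tendsto_id.atTop_mul_const hu0).eventually_ge_atTop R |>.and (eventually_ge_atTop 0)))).exists
  obtain ⟨z, hz, hmass⟩ := exists_norm_eq_mass_eq_mass (fun i => (p i).continuous)
    (g := fun i z => (p i).eval z) (z₁ := r * v) (z₂ := r * u) (by rw [norm_mul, norm_mul, hnorm])
    (hr₂.trans (sq_norm_exp_le_mass (g := fun i z => (p i).eval z)
      (Finset.mem_compl.2 fun h => h₁ ((hA i₀).1 h ▸ h₀))))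
    (hr₁.trans (sq_norm_exp_le_mass (g := fun i z => (p i).eval z) ((hA i₁).2 rfl)))
  refine ⟨z, ?_, hmass⟩
  rw [Set.mem_ofPred_eq, hz, norm_mul, hnorm, norm_real, Real.norm_of_nonneg hr0]
  exact hrR

theorem natDegree_le_of_fubiniStudyDensity_expCurve_le [Fintype ι] {i₀ : ι} (h₀ : p i₀ = 0)
    {C : ℝ} {m : ℕ} (hC : ∀ z : ℂ, 1 ≤ ‖z‖ →
      fubiniStudyDensity (expCurve fun i z => (p i).eval z) z ≤ C * ‖z‖ ^ (2 * m)) (i : ι) :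
    (p i).natDegree ≤ m + 1 := by
  classical
  by_contra! hi
  have : Nonempty ι := ⟨i⟩
  obtain ⟨i₂, hi₂⟩ := Finite.exists_max fun i => (p i).natDegree
  set k := (p i₂).natDegree with hk_def
  have hk : m + 1 < k := hi.trans_le (hi₂ i)
  have hk0 : k ≠ 0 := by omega
  obtain ⟨i₁, hmax⟩ := Finite.exists_max fun i => ‖(p i).coeff k‖
  have h₁ : (p i₁).coeff k ≠ 0 := norm_pos_iff.1 <| (norm_pos_iff.2 <|
    leadingCoeff_ne_zero.2 (ne_zero_of_natDegree_gt (hk0.pos.trans_eq hk_def))).trans_le (hmax i₂)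
  set A : Finset ι := {i | (p i).coeff k = (p i₁).coeff k}
  have hA (i : ι) : i ∈ A ↔ (p i).coeff k = (p i₁).coeff k := by simp [A]
  have hseparated : ∀ᶠ z in cobounded ℂ, ∀ i ∈ A, ∀ j ∈ Aᶜ,
      4 * (C + 1) * ‖z‖ ^ (2 * m) ≤ ‖((p i - p j).derivative ^ 2).eval z‖ := by
    refine (eventually_all_finset A).2 fun i hi => (eventually_all_finset Aᶜ).2 fun j hj =>
      eventually_mul_pow_le_norm_eval ?_ _
    have : k ≤ (p i - p j).natDegree := le_natDegree_of_ne_zero <| by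
      rw [coeff_sub, (hA i).1 hi, sub_ne_zero]
      exact fun h => Finset.mem_compl.1 hj ((hA j).2 h.symm)
    rw [natDegree_pow, natDegree_derivative]
    omega
  have h₀k : (p i₀).coeff k = 0 := by rw [h₀, coeff_zero]
  obtain ⟨z, hbalanced, hz, hz1⟩ := ((frequently_mass_eq_mass_compl hk0 hi₂ h₀k h₁ hmax
    hA).and_eventually (hseparated.and
      (tendsto_norm_cobounded_atTop.eventually_ge_atTop 1))).exists
  have hlower := div_four_le_fubiniStudyDensity_expCurve
    (g := fun i z => (p i).eval z) (fun i => (p i).differentiableAt) hbalanced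
    (c := 4 * (C + 1) * ‖z‖ ^ (2 * m)) fun i hi j hj => by
      have := hz i hi j (Finset.mem_compl.2 hj)
      rwa [eval_pow, norm_pow, derivative_sub, eval_sub, ← Polynomial.deriv,
        ← Polynomial.deriv] at this
  have hz0 : 0 < ‖z‖ ^ (2 * m) := by positivity
  linarith [hC z hz1]

end Degree

section Torus

variable {n : ℕ} {g : Fin n → ℂ → ℂ} {z : ℂ}

theorem affineChart_zero_point (w : Fin n → ℂ) : affineChart 0 (point w) = WithLp.toLp 2 w := by
  rw [point, affineChart, Projectivization.lift_mk]
  ext j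
  simp

theorem point_mem_affineOpen_zero (w : Fin n → ℂ) : point w ∈ affineOpen (0 : Fin (n + 1)) :=
  ⟨Fin.cons 1 w, cons_one_ne_zero w, one_ne_zero, rfl⟩

theorem IsHolomorphic.exists_eq_point_exp {f : ℂ → CP n} (hf : IsHolomorphic f)
    (hX : ∀ z, f z ∈ torus n) :
    ∃ g : Fin n → ℂ → ℂ, (∀ i, Differentiable ℂ (g i)) ∧
      f = fun z => point fun i => exp (g i z) := by
  choose w hw0 hw using hX
  have hchart : Differentiable ℂ fun z => WithLp.toLp 2 (w z) := by
    have hpre : f ⁻¹' affineOpen 0 = Set.univ :=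
      Set.eq_univ_of_forall fun z => Set.mem_preimage.2 <| hw z ▸ point_mem_affineOpen_zero (w z)
    simpa only [hpre, differentiableOn_univ, hw, affineChart_zero_point] using (hf 0).2
  choose g hg hexp using fun i => exists_entire_log (differentiable_euclidean.1 hchart i)
    fun z => hw0 z i
  exact ⟨g, hg, funext fun z => (hw z).trans (congrArg point (funext fun i => hexp i z))⟩

theorem fubiniStudy_self (u v : EuclideanSpace ℂ (Fin n)) :
    fubiniStudy u v v = ((((1 + ‖u‖ ^ 2) * ‖v‖ ^ 2 - ‖inner ℂ u v‖ ^ 2) / (1 + ‖u‖ ^ 2) ^ 2 /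
      (2 * π) : ℝ) : ℂ) := by
  rw [fubiniStudy, inner_self_eq_norm_sq_to_K, ← inner_conj_symm v u, mul_comm (conj _), mul_conj',
    one_div_mul_eq_div]
  push_cast
  rfl

theorem fubiniStudyDensity_expCurve_cons_zero (hg : ∀ i, DifferentiableAt ℂ (g i) z) :
    fubiniStudyDensity (expCurve (Fin.cons 0 g : Fin (n + 1) → ℂ → ℂ)) z =
      ((1 + ‖expCurve g z‖ ^ 2) * ‖deriv (expCurve g) z‖ ^ 2 -
        ‖inner ℂ (expCurve g z) (deriv (expCurve g) z)‖ ^ 2) / (1 + ‖expCurve g z‖ ^ 2) ^ 2 := by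
  have hcons : ∀ i, DifferentiableAt ℂ ((Fin.cons 0 g : Fin (n + 1) → ℂ → ℂ) i) z :=
    Fin.cases (differentiableAt_const 0) hg
  have hnorm : ‖expCurve (Fin.cons 0 g : Fin (n + 1) → ℂ → ℂ) z‖ ^ 2 = 1 + ‖expCurve g z‖ ^ 2 := by
    simp [EuclideanSpace.norm_sq_eq, expCurve, Fin.sum_univ_succ]
  have hderiv : ‖deriv (expCurve (Fin.cons 0 g : Fin (n + 1) → ℂ → ℂ)) z‖ ^ 2 =
      ‖deriv (expCurve g) z‖ ^ 2 := by
    simp [(hasDerivAt_expCurve hcons).deriv, (hasDerivAt_expCurve hg).deriv,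
      EuclideanSpace.norm_sq_eq, Fin.sum_univ_succ]
  have hinner : inner ℂ (expCurve (Fin.cons 0 g : Fin (n + 1) → ℂ → ℂ) z)
      (deriv (expCurve (Fin.cons 0 g : Fin (n + 1) → ℂ → ℂ)) z) =
      inner ℂ (expCurve g z) (deriv (expCurve g) z) := by
    simp [(hasDerivAt_expCurve hcons).deriv, (hasDerivAt_expCurve hg).deriv,
      PiLp.inner_apply, expCurve, Fin.sum_univ_succ]
  rw [fubiniStudyDensity, pow_mul _ 2 2, hnorm, hderiv, hinner]

theorem normDiff_point_exp (hg : ∀ i, Differentiable ℂ (g i)) (z : ℂ) :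
    normDiff (fun z => point fun i => exp (g i z)) z =
      √(fubiniStudyDensity (expCurve (Fin.cons 0 g : Fin (n + 1) → ℂ → ℂ)) z / π) := by
  have hchart (ζ : ℂ) : affineChart 0 (point fun i => exp (g i ζ)) = expCurve g ζ :=
    affineChart_zero_point _
  simp only [normDiff, hchart]
  rw [fubiniStudy_self, ofReal_re, ← fubiniStudyDensity_expCurve_cons_zero fun i => hg i z,
    ← Real.sqrt_mul zero_le_two, ← mul_div_assoc, mul_div_mul_left _ _ two_ne_zero]

theorem normDiff_point_exp_le_iff (hg : ∀ i, Differentiable ℂ (g i)) {B : ℝ} (hB : 0 ≤ B) :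
    normDiff (fun z => point fun i => exp (g i z)) z ≤ B ↔
      fubiniStudyDensity (expCurve (Fin.cons 0 g : Fin (n + 1) → ℂ → ℂ)) z ≤ π * B ^ 2 := by
  rw [normDiff_point_exp hg, Real.sqrt_le_left hB, div_le_iff₀' Real.pi_pos]

theorem exists_polynomial_of_normDiff_le (hg : ∀ i, Differentiable ℂ (g i)) {C : ℝ} (hC : 0 ≤ C)
    {m : ℕ} (hf : ∀ z : ℂ, 1 ≤ ‖z‖ →
      normDiff (fun z => point fun i => exp (g i z)) z ≤ C * ‖z‖ ^ m) :
    ∃ p : Fin n → Polynomial ℂ, (∀ i, (p i).natDegree ≤ m + 1) ∧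
      ∀ i, g i = fun z => (p i).eval z := by
  have hdensity (z : ℂ) (hz : 1 ≤ ‖z‖) :
      fubiniStudyDensity (expCurve (Fin.cons 0 g : Fin (n + 1) → ℂ → ℂ)) z ≤
        π * C ^ 2 * ‖z‖ ^ (2 * m) := by
    rw [pow_mul', mul_assoc, ← mul_pow]
    exact (normDiff_point_exp_le_iff hg (by positivity)).1 (hf z hz)
  have hcons : ∀ i, Differentiable ℂ ((Fin.cons 0 g : Fin (n + 1) → ℂ → ℂ) i) :=
    Fin.cases (differentiable_const 0) hg
  choose p hp using
    exists_polynomial_of_fubiniStudyDensity_expCurve_le hcons (i₀ := 0) rfl hdensity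
  have hp₀ : p 0 = 0 := Polynomial.funext fun z => by simpa using (hp 0 z).symm
  rw [show (Fin.cons 0 g : Fin (n + 1) → ℂ → ℂ) = fun i z => (p i).eval z from
    funext₂ hp] at hdensity
  exact ⟨fun i => p i.succ, fun i => natDegree_le_of_fubiniStudyDensity_expCurve_le hp₀ hdensity _,
    fun i => funext fun z => hp i.succ z⟩

theorem exists_normDiff_le_of_natDegree_le {p : Fin n → Polynomial ℂ} {m : ℕ}
    (hp : ∀ i, (p i).natDegree ≤ m + 1) :
    ∃ C : ℝ, 0 < C ∧ ∀ z : ℂ, 1 ≤ ‖z‖ →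
      normDiff (fun z => point fun i => exp ((p i).eval z)) z ≤ C * ‖z‖ ^ m := by
  set c : Fin n → ℝ := fun i => ∑ k ∈ Finset.range (m + 1), ‖(p i).derivative.coeff k‖
  have hc0 (i : Fin n) : 0 ≤ c i := Finset.sum_nonneg fun _ _ => norm_nonneg _
  set D := 1 + ∑ i, c i
  have hD : 0 < D := add_pos_of_pos_of_nonneg one_pos (Finset.sum_nonneg fun i _ => hc0 i)
  refine ⟨D, hD, fun z hz => ?_⟩
  have hderiv (i : Fin n) : ‖deriv (fun z => (p i).eval z) z‖ ≤ D * ‖z‖ ^ m := by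
    rw [Polynomial.deriv]
    refine (norm_eval_le_of_natDegree_le
      ((p i).natDegree_derivative_le.trans (Nat.sub_le_of_le_add (hp i))) hz).trans ?_
    gcongr
    exact (Finset.single_le_sum (fun i _ => hc0 i) (Finset.mem_univ i)).trans
      (le_add_of_nonneg_left zero_le_one)
  have hcons : ∀ i, Differentiable ℂ
      ((Fin.cons 0 fun i z => (p i).eval z : Fin (n + 1) → ℂ → ℂ) i) :=
    Fin.cases (differentiable_const 0) fun i => (p i).differentiable
  have hdensity := fubiniStudyDensity_expCurve_le (fun i => hcons i z) (Fin.cases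
    ((deriv_const z (0 : ℂ)).symm ▸ norm_zero.trans_le (by positivity)) hderiv)
  refine (normDiff_point_exp_le_iff (fun i => (p i).differentiable) (by positivity)).2 ?_
  exact hdensity.trans (le_mul_of_one_le_left (sq_nonneg _) (by linarith [Real.pi_gt_three]))

end Torus

end TorusCurve

theorem theorem1 (n : ℕ) (f : ℂ → TorusCurve.CP n) (hf : TorusCurve.IsHolomorphic f)
    (hX : ∀ z, f z ∈ TorusCurve.torus n) (m : ℕ) :
    (∃ C : ℝ, 0 < C ∧ ∀ z : ℂ, 1 ≤ ‖z‖ → TorusCurve.normDiff f z ≤ C * ‖z‖ ^ m) ↔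
      ∃ g : Fin n → Polynomial ℂ, (∀ i, (g i).natDegree ≤ m + 1) ∧
        ∀ z : ℂ, f z = TorusCurve.point fun i => Complex.exp ((g i).eval z) := by
  constructor
  · rintro ⟨C, hC, hle⟩
    obtain ⟨g, hg, rfl⟩ := hf.exists_eq_point_exp hX
    obtain ⟨p, hp, hgp⟩ := TorusCurve.exists_polynomial_of_normDiff_le hg hC.le hle
    exact ⟨p, hp, fun z => by simp only [hgp]⟩
  · rintro ⟨p, hp, hfp⟩
    obtain rfl := funext hfp
    exact TorusCurve.exists_normDiff_le_of_natDegree_le hp
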